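/- For $n\in\mathbb{N}_0$ write $(\alpha)_n=\alpha(\alpha+1)\cdots(\alpha+n-1)$, and for real $s$ write $(\alpha)_s=\Gamma(\alpha+s)/\Gamma(\alpha)$. All infinite series below are limits of their partial sums. (i) (Levrie) For every integer $k\ge 0$ the following series converges and $$\sum_{i=0}^{\infty}(-1)^i\,\frac{\left(\frac12\right)_i^3}{(i!)^3}\;\frac{4i+1}{(2i-(2k-1))(2i-(2k-3))\cdots(2i-1)\,(i+1)(i+2)\cdots(i+k)}=(-1)^k\,\frac{1}{2^{k-1}\left(\frac12\right)_k^2}\,\frac1\pi ,$$ where for $k=0$ the denominator is the empty product $1$. (ii) (Generalization) For every real $b>\frac34$ the following series converges and $${}_4F_3\!\left[\begin{matrix}\frac12,\frac12,\frac54,\frac32-b\\ \frac14,1,b\end{matrix};-1\right]=\sum_{i=0}^{\infty}\frac{\left(\frac12\right)_i\left(\frac12\right)_i\left(\frac54\right)_i\left(\frac32-b\right)_i}{\left(\frac14\right)_i(1)_i\,(b)_i}\,\frac{(-1)^i}{i!}=\frac{2\left(b-\frac12\right)_{1/2}}{\sqrt\pi}.$$ -/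

import Mathlib

/-- The Pochhammer symbol `(α)_n = α (α + 1) ⋯ (α + n - 1)` for a nonnegative integer `n`. -/
noncomputable def poch (α : ℝ) (n : ℕ) : ℝ := (ascPochhammer ℝ n).eval α

/-- The Pochhammer symbol `(α)_s = Γ(α + s) / Γ(α)` for a real index `s`. -/
noncomputable def pochReal (α s : ℝ) : ℝ := Real.Gamma (α + s) / Real.Gamma α

/-- The `n`-th term of the generalized hypergeometric series with the list `as` of upper
parameters, the list `bs` of lower parameters and argument `x`. -/
noncomputable def hypTerm (as bs : List ℝ) (x : ℝ) (n : ℕ) : ℝ :=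
  (as.map fun a => poch a n).prod / (bs.map fun b => poch b n).prod *
    (x ^ n / (n.factorial : ℝ))

/-- The series `∑_{n ≥ 0} u n` converges (as the limit of its partial sums, so possibly only
conditionally) and has the sum `s`. -/
def SeriesHasSum (u : ℕ → ℝ) (s : ℝ) : Prop :=
  Filter.Tendsto (fun N : ℕ => ∑ n ∈ Finset.range N, u n) Filter.atTop (nhds s)

/-! Let `S(b)` be the sum of the series in (ii) and `V(b)` its closed form. A telescoping identity
(`sum_wellPoisedTerm_contiguous`) gives `b S(b) = (b - 1/2) S(b + 1)`, and `V` obeys the same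
recursion, so `S/V` is invariant under `b ↦ b + 1`. For `b = m + 3/2` the series terminates and the
recursion gives `S = V` from `S(3/2) = V(3/2) = 1`.

For other `b ≥ 3/2`, comparison with the neighbouring half-integers gives `|S(b) - V(b)| ≤ 6`
uniformly (`exists_sum_near_value`): the initial terms increase with `b` and the tail is
alternating. Since `V(b + n) → ∞`, the invariant ratio must be `1`. One backward step of the
recursion then reaches all `b > 3/4`. Part (i) is the case `b = k + 1` up to a constant factor. -/

open Filter Topology Finset

/-- The square of the normalised central binomial coefficient `(1/2)_i / i!`. -/
noncomputable def halfPochSq (i : ℕ) : ℝ := (poch (1 / 2) i / (i.factorial : ℝ)) ^ 2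

/-- The product `(-1)^i (3/2 - b)_i / (b)_i`. -/
noncomputable def wellPoisedRatio (b : ℝ) (i : ℕ) : ℝ :=
  ∏ j ∈ range i, (b - 3 / 2 - j) / (b + j)

/-- The simplified term of the well-poised series with parameter `b`. -/
noncomputable def wellPoisedTerm (b : ℝ) (i : ℕ) : ℝ :=
  (4 * i + 1) * halfPochSq i * wellPoisedRatio b i

/-! ### Pochhammer symbols and the size of the terms. -/

theorem poch_zero (a : ℝ) : poch a 0 = 1 := by simp [poch]

theorem poch_succ (a : ℝ) (n : ℕ) : poch a (n + 1) = poch a n * (a + n) := by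
  simp [poch, ascPochhammer_succ_right]

theorem poch_one (n : ℕ) : poch 1 n = n.factorial := by
  simp [poch]

theorem poch_pos {a : ℝ} (ha : 0 < a) (n : ℕ) : 0 < poch a n := ascPochhammer_pos n a ha

theorem poch_five_quarters (n : ℕ) : poch (5 / 4) n = (4 * n + 1) * poch (1 / 4) n := by
  induction n with
  | zero => simp [poch_zero]
  | succ n ih => rw [poch_succ, poch_succ, ih]; push_cast; ring

theorem wellPoisedRatio_zero (b : ℝ) : wellPoisedRatio b 0 = 1 := by simp [wellPoisedRatio]

theorem wellPoisedRatio_succ (b : ℝ) (i : ℕ) :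
    wellPoisedRatio b (i + 1) = wellPoisedRatio b i * ((b - 3 / 2 - i) / (b + i)) := by
  rw [wellPoisedRatio, prod_range_succ, ← wellPoisedRatio]

theorem wellPoisedRatio_eq {b : ℝ} (hb : 0 < b) (i : ℕ) :
    wellPoisedRatio b i = (-1) ^ i * poch (3 / 2 - b) i / poch b i := by
  induction i with
  | zero => simp [poch_zero, wellPoisedRatio_zero]
  | succ i ih =>
    have h1 := (poch_pos hb i).ne'
    have h2 : b + i ≠ 0 := by positivity
    rw [wellPoisedRatio_succ, ih, poch_succ, poch_succ]
    field_simp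
    ring

theorem hypTerm_eq_wellPoisedTerm {b : ℝ} (hb : 0 < b) :
    hypTerm [1 / 2, 1 / 2, 5 / 4, 3 / 2 - b] [1 / 4, 1, b] (-1) = wellPoisedTerm b := by
  funext i
  have h1 := (poch_pos hb i).ne'
  have h2 := (poch_pos (show (0 : ℝ) < 1 / 4 by norm_num) i).ne'
  have h3 : (i.factorial : ℝ) ≠ 0 := by positivity
  simp only [hypTerm, wellPoisedTerm, halfPochSq, wellPoisedRatio_eq hb, List.map_cons,
    List.map_nil, List.prod_cons, List.prod_nil, poch_one, poch_five_quarters]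
  field_simp

theorem halfPochSq_zero : halfPochSq 0 = 1 := by simp [halfPochSq, poch_zero]

theorem halfPochSq_succ (i : ℕ) :
    halfPochSq (i + 1) = halfPochSq i * ((i + 1 / 2) / (i + 1)) ^ 2 := by
  have h3 : (i.factorial : ℝ) ≠ 0 := by positivity
  have h4 : (i : ℝ) + 1 ≠ 0 := by positivity
  simp only [halfPochSq, poch_succ, Nat.factorial_succ]
  push_cast
  field_simp
  ring

theorem halfPochSq_pos (i : ℕ) : 0 < halfPochSq i := by
  have := poch_pos (show (0 : ℝ) < 1 / 2 by norm_num) i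
  unfold halfPochSq
  positivity

/-- The left side decreases in `i`, since `(2i + 1)(2i + 3) ≤ 4(i + 1)²`. This makes the weight `(4i
+ 1) * halfPochSq i` bounded, so only the decay of `wellPoisedRatio` matters for convergence. -/
theorem halfPochSq_le (i : ℕ) : halfPochSq i * (2 * i + 1) ≤ 1 := by
  induction i with
  | zero => simp [halfPochSq_zero]
  | succ i ih =>
    have h : ((i + 1 / 2 : ℝ) / (i + 1)) ^ 2 * (2 * (i + 1) + 1) ≤ 2 * i + 1 := by
      rw [div_pow, div_mul_eq_mul_div, div_le_iff₀ (by positivity)]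
      have : (0 : ℝ) ≤ i := by positivity
      nlinarith
    rw [halfPochSq_succ]
    push_cast
    calc _ = halfPochSq i * (((i + 1 / 2 : ℝ) / (i + 1)) ^ 2 * (2 * (i + 1) + 1)) := by ring
      _ ≤ halfPochSq i * (2 * i + 1) := by
        gcongr
        exact (halfPochSq_pos i).le
      _ ≤ 1 := ih

theorem weight_le_two (i : ℕ) : (4 * i + 1) * halfPochSq i ≤ 2 := by
  have := halfPochSq_le i
  have := halfPochSq_pos i
  linarith

/-! ### The contiguous relation between `b` and `b + 1`. -/

theorem wellPoisedRatio_add_one_succ {b : ℝ} (hb : 0 < b) (i : ℕ) :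
    wellPoisedRatio (b + 1) (i + 1) =
      (b - 1 / 2) * b * wellPoisedRatio b i / ((b + i) * (b + i + 1)) := by
  induction i with
  | zero =>
    simp [wellPoisedRatio_succ, wellPoisedRatio_zero]
    have : b + 1 ≠ 0 := by positivity
    field_simp
    ring
  | succ i ih =>
    have h1 : b + i ≠ 0 := by positivity
    have h2 : b + i + 1 ≠ 0 := by positivity
    have h3 : b + i + 1 + 1 ≠ 0 := by positivity
    have h4 : b + 1 + (i + 1) ≠ 0 := by positivity
    rw [wellPoisedRatio_succ, ih, wellPoisedRatio_succ b]
    push_cast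
    rw [show b + (i + 1) = b + i + 1 by ring, show b + 1 + (i + 1 : ℝ) = b + i + 1 + 1 by ring]
    field_simp
    ring

theorem sum_wellPoisedTerm_contiguous {b : ℝ} (hb : 0 < b) (N : ℕ) :
    b * ∑ i ∈ range (N + 1), wellPoisedTerm b i -
        (b - 1 / 2) * ∑ i ∈ range (N + 1), wellPoisedTerm (b + 1) i =
      2 * b * (N + 1 / 2) ^ 2 * halfPochSq N * wellPoisedRatio b N / (N + b) := by
  induction N with
  | zero =>
    simp [wellPoisedTerm, halfPochSq_zero, wellPoisedRatio_zero]
    field_simp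
  | succ N ih =>
    have h1 : b + N ≠ 0 := by positivity
    have h1' : N + b ≠ 0 := by positivity
    have h2 : b + N + 1 ≠ 0 := by positivity
    have h3 : (N : ℝ) + 1 ≠ 0 := by positivity
    have h4 : (N : ℝ) + 1 + b ≠ 0 := by positivity
    rw [sum_range_succ _ (N + 1), sum_range_succ _ (N + 1), mul_add, mul_add, add_sub_add_comm, ih]
    simp only [wellPoisedTerm, wellPoisedRatio_add_one_succ hb, wellPoisedRatio_succ,
      halfPochSq_succ]
    push_cast
    rw [show (N : ℝ) + b = b + N by ring, show (N : ℝ) + 1 + b = b + N + 1 by ring]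
    field_simp
    ring

/-- For `j ≥ b` a factor has absolute value `1 - (2b - 3/2)/(j + b) ≤ exp(-(2b - 3/2)/(j + b))`, and
the harmonic-type sum diverges. The condition `b > 3/4` is exactly `2b - 3/2 > 0`. -/
theorem tendsto_wellPoisedRatio {b : ℝ} (hb : 3 / 4 < b) :
    Tendsto (wellPoisedRatio b) atTop (𝓝 0) := by
  have hdiv : Tendsto (fun n => ∑ j ∈ range n, 1 / ((j : ℝ) + b)) atTop atTop := by
    refine not_summable_iff_tendsto_nat_atTop_of_nonneg (fun j => by positivity) |>.1 ?_
    intro h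
    have := (Real.summable_one_div_nat_add_rpow b 1).1 (by
      refine h.congr fun j => ?_
      rw [Real.rpow_one, abs_of_pos (by positivity)])
    exact lt_irrefl _ this
  obtain ⟨m, hm⟩ := exists_nat_gt b
  -- The first exponential cancels the contribution of `j < m`, where the factor estimate may fail.
  have hbound : ∀ n, |wellPoisedRatio b (n + m)| ≤ |wellPoisedRatio b m| *
      (Real.exp ((2 * b - 3 / 2) * ∑ j ∈ range m, 1 / ((j : ℝ) + b)) *
        Real.exp (-((2 * b - 3 / 2) * ∑ j ∈ range (n + m), 1 / ((j : ℝ) + b)))) := by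
    intro n
    induction n with
    | zero => simp [← Real.exp_add]
    | succ n ih =>
      have hpos : 0 < ((n + m : ℕ) : ℝ) + b := by positivity
      rw [show n + 1 + m = n + m + 1 by ring, wellPoisedRatio_succ, abs_mul, sum_range_succ,
        mul_add, neg_add, Real.exp_add, ← mul_assoc (Real.exp _), ← mul_assoc |wellPoisedRatio b m|]
      refine mul_le_mul ih ?_ (abs_nonneg _) (by positivity)
      have hle : (m : ℝ) ≤ ((n + m : ℕ) : ℝ) := by push_cast; linarith [n.cast_nonneg (α := ℝ)]
      rw [abs_div, abs_of_nonpos (by linarith), abs_of_pos (by linarith)]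
      calc _ = -((2 * b - 3 / 2) * (1 / (((n + m : ℕ) : ℝ) + b))) + 1 := by
            rw [show b + ((n + m : ℕ) : ℝ) = ((n + m : ℕ) : ℝ) + b by ring]
            field_simp
            ring
        _ ≤ _ := Real.add_one_le_exp _
  have hlim : Tendsto (fun n : ℕ => |wellPoisedRatio b m| *
      (Real.exp ((2 * b - 3 / 2) * ∑ j ∈ range m, 1 / ((j : ℝ) + b)) *
        Real.exp (-((2 * b - 3 / 2) * ∑ j ∈ range (n + m), 1 / ((j : ℝ) + b))))) atTop (𝓝 0) := by
    have h1 := (hdiv.comp (tendsto_add_atTop_nat m)).const_mul_atTop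
      (show 0 < 2 * b - 3 / 2 by linarith)
    have h2 := Real.tendsto_exp_neg_atTop_nhds_zero.comp h1
    simpa using (h2.const_mul _).const_mul _
  rw [← tendsto_add_atTop_iff_nat m]
  exact squeeze_zero_norm hbound hlim

theorem abs_wellPoisedTerm_le (b : ℝ) (i : ℕ) :
    |wellPoisedTerm b i| ≤ 2 * |wellPoisedRatio b i| := by
  have := halfPochSq_pos i
  rw [wellPoisedTerm, abs_mul, abs_of_pos (by positivity : 0 < (4 * (i : ℝ) + 1) * halfPochSq i)]
  gcongr
  exact weight_le_two i

theorem tendsto_contiguous {b : ℝ} (hb : 3 / 4 < b) :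
    Tendsto (fun N => b * ∑ i ∈ range N, wellPoisedTerm b i -
        (b - 1 / 2) * ∑ i ∈ range N, wellPoisedTerm (b + 1) i) atTop (𝓝 0) := by
  rw [← tendsto_add_atTop_iff_nat 1]
  have h := (tendsto_wellPoisedRatio hb).abs.const_mul (2 * b)
  rw [abs_zero, mul_zero] at h
  refine squeeze_zero_norm (fun N => ?_) h
  rw [sum_wellPoisedTerm_contiguous (by linarith), Real.norm_eq_abs, abs_div, abs_mul]
  have h1 := halfPochSq_pos N
  have h2 := halfPochSq_le N
  have hN : (0 : ℝ) ≤ N := by positivity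
  have hb0 : 0 < b := by linarith
  rw [abs_of_pos (show 0 < (N : ℝ) + b by positivity), abs_of_pos (by positivity),
    div_le_iff₀ (by positivity)]
  have h3 : (N + 1 / 2 : ℝ) ^ 2 * halfPochSq N ≤ N + b := by
    calc _ = (N + 1 / 2 : ℝ) / 2 * (halfPochSq N * (2 * N + 1)) := by ring
      _ ≤ (N + 1 / 2 : ℝ) / 2 * 1 := by gcongr
      _ ≤ _ := by linarith
  calc _ = 2 * b * |wellPoisedRatio b N| * ((N + 1 / 2 : ℝ) ^ 2 * halfPochSq N) := by ring
    _ ≤ _ := by gcongr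

theorem seriesHasSum_add_one {b s : ℝ} (hb : 3 / 4 < b) (h : SeriesHasSum (wellPoisedTerm b) s) :
    SeriesHasSum (wellPoisedTerm (b + 1)) (s * (b / (b - 1 / 2))) := by
  have hb' : b - 1 / 2 ≠ 0 := by linarith
  have := ((Tendsto.const_mul b h).sub (tendsto_contiguous hb)).div_const (b - 1 / 2)
  unfold SeriesHasSum
  convert this using 2
  · rw [sub_sub_cancel, mul_div_cancel_left₀ _ hb']
  · ring

theorem seriesHasSum_of_add_one {b s : ℝ} (hb : 3 / 4 < b)
    (h : SeriesHasSum (wellPoisedTerm (b + 1)) (s * (b / (b - 1 / 2)))) :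
    SeriesHasSum (wellPoisedTerm b) s := by
  have hb' : b - 1 / 2 ≠ 0 := by linarith
  have hb0 : b ≠ 0 := by linarith
  have := ((Tendsto.const_mul (b - 1 / 2) h).add (tendsto_contiguous hb)).div_const b
  unfold SeriesHasSum
  convert this using 2
  · rw [add_sub_cancel, mul_div_cancel_left₀ _ hb0]
  · rw [mul_div_assoc', mul_div_cancel₀ _ hb', add_zero, mul_div_cancel_right₀ _ hb0]

/-! ### The closed form and the terminating cases. -/

/-- The closed form of the sum of the well-poised series. -/
noncomputable def wellPoisedValue (b : ℝ) : ℝ :=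
  2 * pochReal (b - 1 / 2) (1 / 2) / Real.sqrt Real.pi

theorem wellPoisedValue_add_one {b : ℝ} (hb : 1 / 2 < b) :
    wellPoisedValue (b + 1) = wellPoisedValue b * (b / (b - 1 / 2)) := by
  have h1 : b - 1 / 2 ≠ 0 := by linarith
  have h2 := (Real.Gamma_pos_of_pos (show 0 < b - 1 / 2 by linarith)).ne'
  have h3 : Real.sqrt Real.pi ≠ 0 := by positivity
  simp only [wellPoisedValue, pochReal]
  rw [show b + 1 - 1 / 2 + 1 / 2 = b + 1 by ring, show b + 1 - 1 / 2 = b - 1 / 2 + 1 by ring,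
    Real.Gamma_add_one h1, Real.Gamma_add_one (by linarith), sub_add_cancel]
  field_simp

theorem wellPoisedRatio_half_integer {m i : ℕ} (h : m < i) :
    wellPoisedRatio (m + 3 / 2) i = 0 := by
  refine prod_eq_zero (mem_range.2 h) ?_
  simp

theorem seriesHasSum_half_integer (m : ℕ) :
    SeriesHasSum (wellPoisedTerm (m + 3 / 2)) (wellPoisedValue (m + 3 / 2)) := by
  induction m with
  | zero =>
    have hv : wellPoisedValue ((0 : ℕ) + 3 / 2) = 1 := by
      have h3 : Real.sqrt Real.pi ≠ 0 := by positivity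
      simp only [wellPoisedValue, pochReal]
      norm_num
      rw [show (3 / 2 : ℝ) = 1 / 2 + 1 by norm_num, Real.Gamma_add_one (by norm_num),
        Real.Gamma_one_half_eq]
      field_simp
    rw [hv, SeriesHasSum, ← tendsto_add_atTop_iff_nat 1]
    refine tendsto_const_nhds.congr fun N => ?_
    rw [sum_range_succ', sum_eq_zero]
    · simp [wellPoisedTerm, halfPochSq_zero, wellPoisedRatio_zero]
    · intro i _
      rw [wellPoisedTerm, wellPoisedRatio_half_integer i.succ_pos, mul_zero]
  | succ m ih =>
    have hm : (0 : ℝ) ≤ m := by positivity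
    have := seriesHasSum_add_one (by linarith) ih
    rw [← wellPoisedValue_add_one (by linarith)] at this
    push_cast
    rwa [show (m : ℝ) + 1 + 3 / 2 = m + 3 / 2 + 1 by ring]

theorem sum_half_integer {m N : ℕ} (h : m < N) :
    ∑ i ∈ range N, wellPoisedTerm (m + 3 / 2) i = wellPoisedValue (m + 3 / 2) := by
  refine tendsto_nhds_unique ?_ (seriesHasSum_half_integer m)
  refine tendsto_const_nhds.congr' ?_
  filter_upwards [eventually_ge_atTop N] with M hM
  refine sum_subset (range_subset_range.2 hM) fun i _ hi => ?_
  rw [mem_range, not_lt] at hi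
  rw [wellPoisedTerm, wellPoisedRatio_half_integer (by omega), mul_zero]


/-! ### Square-root bounds for the closed form. -/

/-- Log-convexity of `Γ` at the midpoint of `x` and `x + 1`. -/
theorem Gamma_half_step_le {x : ℝ} (hx : 0 < x) :
    Real.Gamma (x + 1 / 2) ≤ Real.Gamma x * √x := by
  have h := Real.Gamma_mul_add_mul_le_rpow_Gamma_mul_rpow_Gamma hx (show 0 < x + 1 by linarith)
    (show (0 : ℝ) < 1 / 2 by norm_num) (show (0 : ℝ) < 1 / 2 by norm_num) (by norm_num)
  have hG := (Real.Gamma_pos_of_pos hx).le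
  rw [Real.Gamma_add_one hx.ne', ← Real.sqrt_eq_rpow, ← Real.sqrt_eq_rpow, Real.sqrt_mul hx.le,
    mul_left_comm, Real.mul_self_sqrt hG, mul_comm √x] at h
  rwa [show 1 / 2 * x + 1 / 2 * (x + 1) = x + 1 / 2 by ring] at h

theorem pochReal_half_le {x : ℝ} (hx : 0 < x) : pochReal x (1 / 2) ≤ √x := by
  rw [pochReal, div_le_iff₀ (Real.Gamma_pos_of_pos hx), mul_comm]
  exact Gamma_half_step_le hx

theorem le_pochReal_half {x : ℝ} (hx : 1 / 2 ≤ x) : √(x - 1 / 2) ≤ pochReal x (1 / 2) := by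
  have hx0 : 0 < x := by linarith
  have hG := Real.Gamma_pos_of_pos hx0
  -- The upper bound started at `x + 1/2` controls `Γ(x + 1) = x Γ(x)`, hence bounds `Γ(x + 1/2)`
  -- from below.
  have h := Gamma_half_step_le (show 0 < x + 1 / 2 by linarith)
  rw [add_assoc, add_halves, Real.Gamma_add_one hx0.ne'] at h
  rw [pochReal, le_div_iff₀ hG]
  have hs : 0 < √(x + 1 / 2) := Real.sqrt_pos.2 (by linarith)
  have h2 : √(x - 1 / 2) * √(x + 1 / 2) ≤ x := by
    rw [← Real.sqrt_mul (by linarith)]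
    exact Real.sqrt_le_iff.2 ⟨hx0.le, by nlinarith⟩
  refine le_of_mul_le_mul_right ?_ hs
  calc _ = √(x - 1 / 2) * √(x + 1 / 2) * Real.Gamma x := by ring
    _ ≤ x * Real.Gamma x := by gcongr
    _ ≤ _ := h

theorem two_div_sqrt_pi_le : 2 / √Real.pi ≤ 2 := by
  have : 1 ≤ √Real.pi := Real.one_le_sqrt.2 (by linarith [Real.pi_gt_three])
  exact div_le_self (by norm_num) this

theorem wellPoisedValue_eq (b : ℝ) :
    wellPoisedValue b = 2 / √Real.pi * pochReal (b - 1 / 2) (1 / 2) := by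
  rw [wellPoisedValue]
  ring

theorem wellPoisedValue_le {b : ℝ} (hb : 1 / 2 < b) :
    wellPoisedValue b ≤ 2 / √Real.pi * √(b - 1 / 2) := by
  rw [wellPoisedValue_eq]
  gcongr
  exact pochReal_half_le (by linarith)

theorem le_wellPoisedValue {b : ℝ} (hb : 1 ≤ b) :
    2 / √Real.pi * √(b - 1) ≤ wellPoisedValue b := by
  rw [wellPoisedValue_eq]
  gcongr
  have := le_pochReal_half (show 1 / 2 ≤ b - 1 / 2 by linarith)
  rwa [show b - 1 / 2 - 1 / 2 = b - 1 by ring] at this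

theorem wellPoisedValue_pos {b : ℝ} (hb : 1 / 2 < b) : 0 < wellPoisedValue b := by
  have h1 := Real.Gamma_pos_of_pos (show 0 < b - 1 / 2 by linarith)
  have h2 := Real.Gamma_pos_of_pos (show 0 < b - 1 / 2 + 1 / 2 by linarith)
  unfold wellPoisedValue pochReal
  positivity

/-! ### Monotonicity of the head, alternation of the tail. -/

theorem wellPoisedRatio_nonneg {m i : ℕ} {b : ℝ} (hb : (m : ℝ) + 3 / 2 ≤ b) (hi : i ≤ m + 1) :
    0 ≤ wellPoisedRatio b i := by
  refine prod_nonneg fun j hj => ?_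
  have hj' : (j : ℝ) ≤ m := by
    have := mem_range.1 hj
    exact_mod_cast (by omega : j ≤ m)
  have : (0 : ℝ) ≤ j := by positivity
  exact div_nonneg (by linarith) (by linarith)

/-- Every factor involved is nonnegative and equals `1 - (2j + 3/2)/(b + j)`, which increases with
`b`. -/
theorem wellPoisedTerm_mono {m i : ℕ} {b c : ℝ} (hb : (m : ℝ) + 3 / 2 ≤ b) (hbc : b ≤ c)
    (hi : i ≤ m + 1) : wellPoisedTerm b i ≤ wellPoisedTerm c i := by
  have := halfPochSq_pos i
  refine mul_le_mul_of_nonneg_left ?_ (by positivity)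
  refine prod_le_prod (fun j hj => ?_) fun j hj => ?_
  all_goals
    have hj' : (j : ℝ) ≤ m := by
      have := mem_range.1 hj
      exact_mod_cast (by omega : j ≤ m)
    have : (0 : ℝ) ≤ j := by positivity
  · exact div_nonneg (by linarith) (by linarith)
  · rw [div_le_div_iff₀ (by linarith) (by linarith)]
    nlinarith

/-- Beyond the index where its factors change sign, the series is alternating. -/
theorem alternating_tail {m : ℕ} {b : ℝ} (hb : (m : ℝ) + 3 / 2 ≤ b) (hb' : b ≤ m + 5 / 2) :
    ∃ a : ℕ → ℝ, Antitone a ∧ Tendsto a atTop (𝓝 0) ∧ a 0 ≤ 2 ∧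
      ∀ n, wellPoisedTerm b (n + (m + 2)) = -((-1) ^ n * a n) := by
  have hm : (0 : ℝ) ≤ m := by positivity
  have hsq : ∀ n : ℕ, ((-1 : ℝ) ^ n) * (-1) ^ n = 1 := fun n => by
    rw [← mul_pow]; simp
  -- Factors with `j ≤ m` are nonnegative and those with `j ≥ m + 1` nonpositive. Index `m + 2` is
  -- the first to include one of the latter, whence the leading minus sign.
  have hnonneg : ∀ n : ℕ, 0 ≤ -(-1) ^ n * wellPoisedRatio b (n + (m + 2)) := by
    intro n
    induction n with
    | zero =>
      have h := wellPoisedRatio_nonneg hb le_rfl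
      rw [zero_add, wellPoisedRatio_succ, pow_zero, neg_one_mul, ← mul_neg, ← neg_div]
      refine mul_nonneg h (div_nonneg ?_ ?_) <;> push_cast <;> linarith
    | succ n ih =>
      rw [show n + 1 + (m + 2) = n + (m + 2) + 1 by ring, wellPoisedRatio_succ, pow_succ]
      have h : 0 ≤ (((n + (m + 2) : ℕ) : ℝ) + 3 / 2 - b) / (b + ((n + (m + 2) : ℕ) : ℝ)) := by
        have : (0 : ℝ) ≤ n := by positivity
        refine div_nonneg ?_ ?_ <;> push_cast <;> linarith
      calc 0 ≤ _ := mul_nonneg ih h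
        _ = _ := by ring
  have hP0 : ∀ k ≤ m + 2, |wellPoisedRatio b k| ≤ 1 := by
    intro k hk
    rw [wellPoisedRatio, abs_prod]
    refine prod_le_one (fun j _ => abs_nonneg _) fun j hj => ?_
    have hj' : (j : ℝ) ≤ m + 1 := by
      have := mem_range.1 hj
      exact_mod_cast (by omega : j ≤ m + 1)
    have : (0 : ℝ) ≤ j := by positivity
    rw [abs_div, div_le_one (abs_pos.2 (by linarith)), abs_of_pos (by linarith : 0 < b + j), abs_le]
    constructor <;> linarith
  refine ⟨fun n => -(-1) ^ n * wellPoisedTerm b (n + (m + 2)), antitone_nat_of_succ_le fun n => ?_,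
    ?_, ?_, fun n => ?_⟩
  · rw [show n + 1 + (m + 2) = n + (m + 2) + 1 by ring]
    have hn := hnonneg n
    set i : ℕ := n + (m + 2) with hi
    have hi' : (m : ℝ) + 2 ≤ i := by rw [hi]; push_cast; linarith [n.cast_nonneg (α := ℝ)]
    have hh := halfPochSq_pos i
    have hbi : 0 < b + i := by linarith
    have hi0 : (0 : ℝ) ≤ i := by positivity
    have key : (4 * (i + 1 : ℝ) + 1) * ((i + 1 / 2) / (i + 1)) ^ 2 *
        ((i + 3 / 2 - b) / (b + i)) ≤ 4 * i + 1 := by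
      rw [div_pow, mul_div_assoc' (4 * (i + 1 : ℝ) + 1), div_mul_div_comm,
        div_le_iff₀ (by positivity)]
      -- As `(4i + 5)(i + 1/2)²` exceeds `(4i + 1)(i + 1)²` by exactly `1/4`, the goal amounts to
      -- `(i + 3/2 - b)/4 ≤ (4i + 1)(i + 1)²(2b - 3/2)`, for which this crude bound suffices.
      have hX : (1 : ℝ) + 6 * i ≤ (4 * i + 1) * (i + 1) ^ 2 := by
        have := pow_nonneg hi0 2
        have := pow_nonneg hi0 3
        nlinarith
      have := mul_le_mul_of_nonneg_right hX (show 0 ≤ 2 * b - 3 / 2 by linarith)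
      nlinarith
    calc _ = halfPochSq i * (-(-1) ^ n * wellPoisedRatio b i) *
          ((4 * (i + 1 : ℝ) + 1) * ((i + 1 / 2) / (i + 1)) ^ 2 * ((i + 3 / 2 - b) / (b + i))) := by
          rw [wellPoisedTerm, halfPochSq_succ, wellPoisedRatio_succ, pow_succ]
          push_cast
          ring
      _ ≤ halfPochSq i * (-(-1) ^ n * wellPoisedRatio b i) * (4 * i + 1) := by gcongr
      _ = _ := by rw [wellPoisedTerm]; ring
  · have h := ((tendsto_wellPoisedRatio (show 3 / 4 < b by linarith)).abs.const_mul 2).comp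
      (tendsto_add_atTop_nat (m + 2))
    rw [abs_zero, mul_zero] at h
    refine squeeze_zero_norm (fun n => ?_) h
    rw [norm_mul, norm_neg, norm_pow, norm_neg, norm_one, one_pow, one_mul]
    exact abs_wellPoisedTerm_le _ _
  · have h1 := abs_wellPoisedTerm_le b (m + 2)
    have h2 := hP0 (m + 2) le_rfl
    have h3 := neg_le_abs (wellPoisedTerm b (m + 2))
    simp only [pow_zero, zero_add, neg_one_mul]
    linarith
  · rw [← mul_assoc, mul_neg, hsq, neg_mul, one_mul, neg_neg]

/-- The constant is `6 = 2 + 4`: the alternating tail contributes at most `2`, while the head and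
`wellPoisedValue b` both lie between `(2/√π)√(m + 1/2)` and `(2/√π)√(m + 2)`, which differ by at
most `4`. Only the independence of `b` matters. -/
theorem exists_sum_near_value {b : ℝ} (hb : 3 / 2 ≤ b) :
    ∃ s, SeriesHasSum (wellPoisedTerm b) s ∧ |s - wellPoisedValue b| ≤ 6 := by
  obtain ⟨m, hm⟩ : ∃ m : ℕ, m = ⌊b - 3 / 2⌋₊ := ⟨_, rfl⟩
  have hm1 : (m : ℝ) + 3 / 2 ≤ b := by
    have := Nat.floor_le (show 0 ≤ b - 3 / 2 by linarith)
    rw [← hm] at this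
    linarith
  have hm2 : b ≤ m + 5 / 2 := by
    have := Nat.lt_floor_add_one (b - 3 / 2)
    rw [← hm] at this
    linarith
  have hm0 : (0 : ℝ) ≤ m := by positivity
  obtain ⟨a, hanti, hlim, ha0, hterm⟩ := alternating_tail hm1 hm2
  obtain ⟨l, hl⟩ := hanti.tendsto_alternating_series_of_tendsto_zero hlim
  have hl0 : 0 ≤ l := by simpa using hanti.alternating_series_le_tendsto hl 0
  have hl2 : l ≤ 2 := by
    have := hanti.tendsto_le_alternating_series hl 0
    simp at this
    linarith
  refine ⟨∑ i ∈ range (m + 2), wellPoisedTerm b i - l, ?_, ?_⟩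
  · rw [SeriesHasSum, ← tendsto_add_atTop_iff_nat (m + 2)]
    refine (hl.const_sub (∑ i ∈ range (m + 2), wellPoisedTerm b i)).congr fun N => ?_
    have htail : ∑ n ∈ range N, wellPoisedTerm b (m + 2 + n) =
        -∑ n ∈ range N, (-1) ^ n * a n := by
      rw [← sum_neg_distrib]
      exact sum_congr rfl fun n _ => by rw [← hterm, add_comm]
    rw [add_comm N, sum_range_add _ (m + 2) N, htail, sub_eq_add_neg]
  · have hlow : wellPoisedValue (m + 3 / 2) ≤ ∑ i ∈ range (m + 2), wellPoisedTerm b i := by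
      rw [← sum_half_integer (show m < m + 2 by omega)]
      exact sum_le_sum fun i hi => wellPoisedTerm_mono le_rfl hm1 (by
        have := mem_range.1 hi
        omega)
    -- At `m + 5/2` the series stops at index `m + 1`, so the head has exactly the length of this
    -- full sum.
    have hup : ∑ i ∈ range (m + 2), wellPoisedTerm b i ≤ wellPoisedValue (m + 5 / 2) := by
      have := sum_half_integer (show m + 1 < m + 2 by omega)
      rw [show ((m + 1 : ℕ) : ℝ) + 3 / 2 = m + 5 / 2 by push_cast; ring] at this
      rw [← this]
      exact sum_le_sum fun i hi => wellPoisedTerm_mono hm1 hm2 (by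
        have := mem_range.1 hi
        omega)
    have hκ := two_div_sqrt_pi_le
    have hκ0 : 0 ≤ 2 / √Real.pi := by positivity
    have h1 : 2 / √Real.pi * √(m + 1 / 2) ≤ wellPoisedValue (m + 3 / 2) := by
      have := le_wellPoisedValue (show 1 ≤ (m : ℝ) + 3 / 2 by linarith)
      rwa [show (m : ℝ) + 3 / 2 - 1 = m + 1 / 2 by ring] at this
    have h2 : wellPoisedValue (m + 5 / 2) ≤ 2 / √Real.pi * √(m + 2) := by
      have := wellPoisedValue_le (show 1 / 2 < (m : ℝ) + 5 / 2 by linarith)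
      rwa [show (m : ℝ) + 5 / 2 - 1 / 2 = m + 2 by ring] at this
    have h3 : 2 / √Real.pi * √(m + 1 / 2) ≤ wellPoisedValue b :=
      le_trans (by gcongr; linarith) (le_wellPoisedValue (by linarith))
    have h4 : wellPoisedValue b ≤ 2 / √Real.pi * √(m + 2) :=
      le_trans (wellPoisedValue_le (by linarith)) (by gcongr; linarith)
    have h5 : √(m + 2 : ℝ) ≤ √(m + 1 / 2) + 2 := by
      refine Real.sqrt_le_iff.2 ⟨by positivity, ?_⟩
      have := Real.sq_sqrt (show (0 : ℝ) ≤ m + 1 / 2 by linarith)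
      nlinarith [Real.sqrt_nonneg ((m : ℝ) + 1 / 2)]
    have h6 : 2 / √Real.pi * √(m + 2 : ℝ) ≤ 2 / √Real.pi * √(m + 1 / 2) + 4 := by
      calc _ ≤ 2 / √Real.pi * (√(m + 1 / 2) + 2) := by gcongr
        _ ≤ _ := by linarith
    rw [abs_le]
    constructor <;> linarith

/-! ### Rigidity under integer shifts, and part (ii). -/

theorem wellPoisedValue_tendsto {b : ℝ} :
    Tendsto (fun n : ℕ => wellPoisedValue (b + n)) atTop atTop := by
  have h : Tendsto (fun n : ℕ => 2 / √Real.pi * √(b + n - 1)) atTop atTop := by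
    refine (Real.tendsto_sqrt_atTop.comp ?_).const_mul_atTop (by positivity)
    exact tendsto_atTop_add_const_right _ (-1)
      (tendsto_atTop_add_const_left _ b tendsto_natCast_atTop_atTop)
  refine tendsto_atTop_mono' _ ?_ h
  obtain ⟨k, hk⟩ := exists_nat_ge (1 - b)
  filter_upwards [eventually_ge_atTop k] with n hn
  have : (k : ℝ) ≤ n := by exact_mod_cast hn
  exact le_wellPoisedValue (by linarith)

theorem seriesHasSum_shift {b r : ℝ} (hb : 3 / 4 < b) (n : ℕ)
    (h : SeriesHasSum (wellPoisedTerm b) (r * wellPoisedValue b)) :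
    SeriesHasSum (wellPoisedTerm (b + n)) (r * wellPoisedValue (b + n)) := by
  induction n with
  | zero => simpa using h
  | succ n ih =>
    have hn : (0 : ℝ) ≤ n := by positivity
    have := seriesHasSum_add_one (by linarith) ih
    rw [mul_assoc, ← wellPoisedValue_add_one (by linarith)] at this
    push_cast
    rwa [← add_assoc]

theorem seriesHasSum_wellPoisedTerm_of_ge {b : ℝ} (hb : 3 / 2 ≤ b) :
    SeriesHasSum (wellPoisedTerm b) (wellPoisedValue b) := by
  obtain ⟨s, hs, -⟩ := exists_sum_near_value hb
  have hV := wellPoisedValue_pos (show 1 / 2 < b by linarith)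
  obtain ⟨r, rfl⟩ : ∃ r, s = r * wellPoisedValue b := ⟨s / wellPoisedValue b, by field_simp⟩
  -- The relative error `r - 1` survives every shift, while the absolute error stays bounded.
  have hbound : ∀ n : ℕ, |r - 1| * wellPoisedValue (b + n) ≤ 6 := by
    intro n
    have hn : (0 : ℝ) ≤ n := by positivity
    obtain ⟨t, ht, htV⟩ := exists_sum_near_value (show 3 / 2 ≤ b + n by linarith)
    rw [tendsto_nhds_unique ht (seriesHasSum_shift (by linarith) n hs)] at htV
    rwa [← sub_one_mul, abs_mul, abs_of_pos (wellPoisedValue_pos (by linarith))] at htV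
  have hr : r = 1 := by
    by_contra hne
    have hpos : 0 < |r - 1| := abs_pos.2 (sub_ne_zero.2 hne)
    obtain ⟨n, hn⟩ := ((wellPoisedValue_tendsto (b := b)).const_mul_atTop hpos).eventually_gt_atTop 6
      |>.exists
    exact absurd (hbound n) (not_le.2 hn)
  rwa [hr, one_mul] at hs

theorem seriesHasSum_wellPoisedTerm {b : ℝ} (hb : 3 / 4 < b) :
    SeriesHasSum (wellPoisedTerm b) (wellPoisedValue b) := by
  refine seriesHasSum_of_add_one hb ?_
  rw [← wellPoisedValue_add_one (by linarith)]
  exact seriesHasSum_wellPoisedTerm_of_ge (by linarith)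

/-! ### Levrie's series as the case `b = k + 1`. -/

theorem poch_half_eq_Gamma (k : ℕ) :
    Real.Gamma (k + 1 / 2) = poch (1 / 2) k * √Real.pi := by
  induction k with
  | zero => rw [Nat.cast_zero, zero_add, Real.Gamma_one_half_eq, poch_zero, one_mul]
  | succ k ih =>
    push_cast
    rw [show (k : ℝ) + 1 + 1 / 2 = k + 1 / 2 + 1 by ring, Real.Gamma_add_one (by positivity), ih,
      poch_succ]
    ring

theorem wellPoisedValue_nat (k : ℕ) :
    wellPoisedValue (k + 1) = 2 * k.factorial / (poch (1 / 2) k * Real.pi) := by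
  rw [wellPoisedValue, pochReal, sub_add_cancel, Real.Gamma_nat_eq_factorial,
    show (k : ℝ) + 1 - 1 / 2 = k + 1 / 2 by ring, poch_half_eq_Gamma, mul_div_assoc', div_div,
    mul_assoc, Real.mul_self_sqrt Real.pi_pos.le]

/-- Passing from `k` to `k + 1` in Levrie's denominator adds, up to the factor `-2`, exactly the two
factors on the left at `b = k + 1`. -/
theorem wellPoisedRatio_add_one_mul {b : ℝ} (hb : 0 < b) (i : ℕ) :
    wellPoisedRatio (b + 1) i * ((b + i) * (b - 1 / 2 - i)) =
      (b - 1 / 2) * b * wellPoisedRatio b i := by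
  have h := wellPoisedRatio_add_one_succ hb i
  have h1 : b + i ≠ 0 := by positivity
  have h2 : b + i + 1 ≠ 0 := by positivity
  rw [wellPoisedRatio_succ, eq_div_iff (mul_ne_zero h1 h2), add_right_comm] at h
  rw [← h]
  field_simp
  ring

theorem two_mul_sub_odd_ne_zero (i j : ℕ) : 2 * (i : ℝ) - (2 * (j : ℝ) - 1) ≠ 0 := by
  intro h
  have : ((2 * i + 1 : ℕ) : ℝ) = (2 * j : ℕ) := by push_cast; linarith
  have := Nat.cast_injective this
  omega

/-- The factors of Levrie's series rewritten as a ratio of Pochhammer symbols. -/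
theorem wellPoisedRatio_nat (k i : ℕ) :
    wellPoisedRatio (k + 1) i *
        ((∏ j ∈ Icc 1 k, (2 * (i : ℝ) - (2 * (j : ℝ) - 1))) * ∏ j ∈ Icc 1 k, ((i : ℝ) + (j : ℝ))) =
      (-1) ^ i * (poch (1 / 2) i / i.factorial) *
        ((-1) ^ k * 2 ^ k * poch (1 / 2) k * k.factorial) := by
  induction k with
  | zero =>
    simp only [Nat.cast_zero, zero_add]
    rw [wellPoisedRatio_eq one_pos, poch_one]
    norm_num [poch_zero]
    ring
  | succ k ih =>
    have hk : (0 : ℝ) < k + 1 := by positivity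
    rw [← insert_Icc_right_eq_Icc_add_one (by omega : 1 ≤ k + 1), prod_insert (by simp),
      prod_insert (by simp)]
    have h := wellPoisedRatio_add_one_mul hk i
    rw [poch_succ, Nat.factorial_succ]
    push_cast
    linear_combination
      (-2 * (∏ j ∈ Icc 1 k, (2 * (i : ℝ) - (2 * (j : ℝ) - 1))) * ∏ j ∈ Icc 1 k, ((i : ℝ) + j)) * h -
        2 * (k + 1 / 2) * (k + 1) * ih

theorem levrie_term (k i : ℕ) :
    (-1 : ℝ) ^ i * (poch (1 / 2) i ^ 3 / (i.factorial : ℝ) ^ 3) *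
        ((4 * (i : ℝ) + 1) /
          ((∏ j ∈ Icc 1 k, (2 * (i : ℝ) - (2 * (j : ℝ) - 1))) *
            ∏ j ∈ Icc 1 k, ((i : ℝ) + (j : ℝ)))) =
      wellPoisedTerm (k + 1) i * ((-1) ^ k / (2 ^ k * poch (1 / 2) k * k.factorial)) := by
  have h1 := wellPoisedRatio_nat k i
  have hA : ∏ j ∈ Icc 1 k, (2 * (i : ℝ) - (2 * (j : ℝ) - 1)) ≠ 0 :=
    prod_ne_zero_iff.2 fun j _ => two_mul_sub_odd_ne_zero i j
  have hB : ∏ j ∈ Icc 1 k, ((i : ℝ) + (j : ℝ)) ≠ 0 :=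
    prod_ne_zero_iff.2 fun j hj => by
      have : 0 < j := (mem_Icc.1 hj).1
      positivity
  have hsq : ((-1 : ℝ) ^ k) * (-1) ^ k = 1 := by rw [← mul_pow]; simp
  have hp := (poch_pos (show (0 : ℝ) < 1 / 2 by norm_num) k).ne'
  have hf : (k.factorial : ℝ) ≠ 0 := by positivity
  rw [← eq_div_iff (mul_ne_zero hA hB)] at h1
  rw [wellPoisedTerm, h1, halfPochSq]
  field_simp
  rw [sq, hsq, mul_one]

theorem theorem4 :
    (∀ k : ℕ,
      SeriesHasSum
        (fun i : ℕ =>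
          (-1 : ℝ) ^ i * (poch (1 / 2) i ^ 3 / (i.factorial : ℝ) ^ 3) *
            ((4 * (i : ℝ) + 1) /
              ((∏ j ∈ Finset.Icc 1 k, (2 * (i : ℝ) - (2 * (j : ℝ) - 1))) *
                ∏ j ∈ Finset.Icc 1 k, ((i : ℝ) + (j : ℝ)))))
        ((-1 : ℝ) ^ k * (1 / ((2 : ℝ) ^ ((k : ℤ) - 1) * poch (1 / 2) k ^ 2)) *
          (1 / Real.pi))) ∧
    (∀ b : ℝ, 3 / 4 < b →
      SeriesHasSum
        (hypTerm [1 / 2, 1 / 2, 5 / 4, 3 / 2 - b] [1 / 4, 1, b] (-1))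
        (2 * pochReal (b - 1 / 2) (1 / 2) / Real.sqrt Real.pi)) := by
  refine ⟨fun k => ?_, fun b hb => ?_⟩
  · have hk : (0 : ℝ) ≤ k := by positivity
    have h := Tendsto.mul_const ((-1) ^ k / (2 ^ k * poch (1 / 2) k * k.factorial))
      (seriesHasSum_wellPoisedTerm (show 3 / 4 < (k : ℝ) + 1 by linarith))
    have hp := (poch_pos (show (0 : ℝ) < 1 / 2 by norm_num) k).ne'
    have hf : (k.factorial : ℝ) ≠ 0 := by positivity
    unfold SeriesHasSum
    convert h using 2
    · rw [sum_mul]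
      exact sum_congr rfl fun i _ => levrie_term k i
    -- The exponent `k - 1` is an integer, equal to `-1` at `k = 0`, so it is split as `2 ^ k / 2`.
    · rw [wellPoisedValue_nat, zpow_sub₀ two_ne_zero, zpow_natCast, zpow_one]
      field_simp
  · rw [hypTerm_eq_wellPoisedTerm (by linarith)]
    exact seriesHasSum_wellPoisedTerm hb
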